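/- Let $A$ be a unital $C^*$-algebra, let $G$ be a discrete group, and let $\alpha : G \to \mathrm{Aut}(A)$ be a homomorphism into the group of $*$-automorphisms of $A$. Let $A \rtimes G$ be the full crossed product, i.e. the completion of the $\alpha$-twisted convolution $*$-algebra $C_c(G,A)$ in the norm $\|f\| = \sup_{(\pi,U)} \big\| \sum_{g \in G} \pi(f(g))\,U_g \big\|$, the supremum being taken over all covariant representations $(\pi,U)$ of $(A,G,\alpha)$ on Hilbert spaces, and regard $A$ as a unital $C^*$-subalgebra of $A \rtimes G$ by identifying $a \in A$ with the function that takes the value $a$ at the identity $e$ of $G$ and $0$ elsewhere. A conditional expectation for $A \subseteq A \rtimes G$ is a unital completely positive map $E : A \rtimes G \to A$ such that $E(a) = a$ for all $a \in A$. One says that $G$ acts freely on $A$ if for every $g \in G$ with $g \neq e$, the only $b \in A$ such that $ba = \alpha_g(a)b$ for all $a \in A$ is $b = 0$. Then there is exactly one conditional expectation for $A \subseteq A \rtimes G$ if and only if $G$ acts freely on $A$. -/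

import Mathlib

open scoped CStarAlgebra

noncomputable section

universe u v

/-- An automorphism `φ` of a C⋆-algebra `A` is *freely acting* if it has no non-zero dependent
element, i.e. if the only `b` with `b a = φ(a) b` for all `a` is `b = 0`. -/
def FreelyActing {A : Type*} [CStarAlgebra A] (φ : A ≃⋆ₐ[ℂ] A) : Prop :=
  ∀ b : A, (∀ a : A, b * a = φ a * b) → b = 0

/-- The action `α` of the discrete group `G` on `A` is *free* if `α g` is freely acting for
every `g ≠ 1`. -/
def ActsFreely {A : Type*} {G : Type*} [CStarAlgebra A] [Group G]
    (α : G →* (A ≃⋆ₐ[ℂ] A)) : Prop :=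
  ∀ g : G, g ≠ 1 → FreelyActing (α g)

/-- `E` is a *conditional expectation* for the unital inclusion `ι` of `A` into `B`: it is a unital
completely positive map `B → A` that restricts to the identity of `A`. -/
structure IsConditionalExpectation {A : Type*} {B : Type*} [CStarAlgebra A] [PartialOrder A]
    [StarOrderedRing A] [CStarAlgebra B] [PartialOrder B] [StarOrderedRing B]
    (ι : A →⋆ₐ[ℂ] B) (E : B →CP A) : Prop where
  map_one : E 1 = 1
  map_incl : ∀ a : A, E (ι a) = a

section Dynamics

variable {A : Type u} {G : Type v} [CStarAlgebra A] [Group G]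

/-- The action of `G` on the ring `A` given by `g • a = α g a`. -/
@[reducible] def dynAction (α : G →* (A ≃⋆ₐ[ℂ] A)) : MulSemiringAction G A where
  smul g a := α g a
  one_smul a := by change α 1 a = a; rw [map_one]; rfl
  mul_smul g h a := by change α (g * h) a = α g (α h a); rw [map_mul]; rfl
  smul_zero g := map_zero (α g)
  smul_add g := map_add (α g)
  smul_one g := map_one (α g)
  smul_mul g := map_mul (α g)

/-- The `α`-twisted convolution algebra `C_c(G, A)` of finitely supported functions `G → A`,
realised as the skew group ring: the element `∑ a_g g` is the function `g ↦ a_g`. -/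
def ConvAlgebra (_α : G →* (A ≃⋆ₐ[ℂ] A)) : Type (max u v) := SkewMonoidAlgebra A G

namespace ConvAlgebra

variable (α : G →* (A ≃⋆ₐ[ℂ] A))

instance instRing : Ring (ConvAlgebra α) :=
  letI := dynAction α
  inferInstanceAs (Ring (SkewMonoidAlgebra A G))

instance instModule : Module ℂ (ConvAlgebra α) :=
  inferInstanceAs (Module ℂ (SkewMonoidAlgebra A G))

/-- The element `a g` of `C_c(G, A)`: the function with value `a` at `g` and zero elsewhere. -/
def single (g : G) (a : A) : ConvAlgebra α := SkewMonoidAlgebra.single g a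

theorem single_zero (g : G) : single α g 0 = 0 := SkewMonoidAlgebra.single_zero g

theorem single_add (g : G) (a b : A) : single α g (a + b) = single α g a + single α g b :=
  SkewMonoidAlgebra.single_add g a b

theorem smul_single (c : ℂ) (g : G) (a : A) : c • single α g a = single α g (c • a) :=
  SkewMonoidAlgebra.smul_single c g a

theorem one_def : (1 : ConvAlgebra α) = single α 1 1 := rfl

theorem single_mul_single (g h : G) (a b : A) :
    single α g a * single α h b = single α (g * h) (a * α g b) :=
  letI := dynAction α
  SkewMonoidAlgebra.single_mul_single (k := A) (G := G)

variable {α} in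
theorem induction_on {p : ConvAlgebra α → Prop} (f : ConvAlgebra α) (h_zero : p 0)
    (h_single : ∀ g a, p (single α g a)) (h_add : ∀ f g, p f → p g → p (f + g)) : p f :=
  SkewMonoidAlgebra.induction_on (p := p) f h_zero h_single h_add

instance instAlgebra : Algebra ℂ (ConvAlgebra α) :=
  Algebra.ofModule
    (fun c x y => by
      induction x using induction_on with
      | h_zero => simp
      | h_add f g hf hg => rw [smul_add, add_mul, add_mul, smul_add, hf, hg]
      | h_single g a =>
        induction y using induction_on with
        | h_zero => simp
        | h_add f g hf hg => rw [mul_add, mul_add, smul_add, hf, hg]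
        | h_single h b => simp only [smul_single, single_mul_single, smul_mul_assoc])
    (fun c x y => by
      induction x using induction_on with
      | h_zero => simp
      | h_add f g hf hg => rw [add_mul, add_mul, smul_add, hf, hg]
      | h_single g a =>
        induction y using induction_on with
        | h_zero => simp
        | h_add f g hf hg => rw [smul_add, mul_add, mul_add, smul_add, hf, hg]
        | h_single h b => simp only [smul_single, single_mul_single, map_smul, mul_smul_comm])

/-- The additive map `C_c(G, A) → M` with prescribed values on the elements `a g`. -/
def liftAdd {M : Type*} [AddCommMonoid M] (F : G → A →+ M) : ConvAlgebra α →+ M :=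
  (Finsupp.liftAddHom F).comp
    (SkewMonoidAlgebra.coeffAddEquiv (k := A) (G := G)).toAddMonoidHom

theorem liftAdd_single {M : Type*} [AddCommMonoid M] (F : G → A →+ M) (g : G) (a : A) :
    liftAdd α F (single α g a) = F g a :=
  Finsupp.liftAddHom_apply_single F g a

/-- The involution of `C_c(G, A)`, determined by `(a g)⋆ = g⁻¹ a⋆ = α_{g⁻¹}(a⋆) g⁻¹`. -/
def starHom : ConvAlgebra α →+ ConvAlgebra α :=
  liftAdd α fun g =>
    { toFun := fun a => single α g⁻¹ (α g⁻¹ (star a))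
      map_zero' := by simp [single_zero]
      map_add' := fun a b => by simp [single_add] }

instance instStar : Star (ConvAlgebra α) := ⟨starHom α⟩

theorem star_single (g : G) (a : A) :
    star (single α g a) = single α g⁻¹ (α g⁻¹ (star a)) :=
  liftAdd_single α _ g a

theorem star_add_aux (x y : ConvAlgebra α) : star (x + y) = star x + star y :=
  map_add (starHom α) x y

theorem star_zero_aux : star (0 : ConvAlgebra α) = 0 := map_zero (starHom α)

theorem act_mul (g h : G) (a : A) : α (g * h) a = α g (α h a) := by rw [map_mul]; rfl

theorem act_one (a : A) : α 1 a = a := by rw [map_one]; rfl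

instance instStarRing : StarRing (ConvAlgebra α) where
  star_involutive x := by
    induction x using induction_on with
    | h_zero => rw [star_zero_aux, star_zero_aux]
    | h_single g a =>
      rw [star_single, star_single, ← map_star, star_star, ← act_mul, inv_inv, mul_inv_cancel,
        act_one]
    | h_add f g hf hg => rw [star_add_aux, star_add_aux, hf, hg]
  star_mul x y := by
    induction x using induction_on with
    | h_zero => rw [zero_mul, star_zero_aux, mul_zero]
    | h_add f g hf hg => rw [add_mul, star_add_aux, star_add_aux, hf, hg, mul_add]
    | h_single g a =>
      induction y using induction_on with
      | h_zero => rw [mul_zero, star_zero_aux, zero_mul]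
      | h_add f g hf hg => rw [mul_add, star_add_aux, star_add_aux, hf, hg, add_mul]
      | h_single h b =>
        simp only [star_single, single_mul_single, star_mul, mul_inv_rev, ← map_star]
        rw [map_mul, ← act_mul, inv_mul_cancel_right, ← act_mul]
  star_add := star_add_aux α

instance instStarModule : StarModule ℂ (ConvAlgebra α) where
  star_smul c x := by
    induction x using induction_on with
    | h_zero => rw [smul_zero, star_zero_aux, smul_zero]
    | h_single g a => simp only [smul_single, star_single, star_smul, map_smul]
    | h_add f g hf hg => rw [smul_add, star_add_aux, star_add_aux, hf, hg, smul_add]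

end ConvAlgebra

/-- A covariant representation of `(A, G, α)`: a unital `⋆`-representation `π` of `A` and a unitary
representation `U` of `G` on one Hilbert space such that `π(α_g(a)) = U_g π(a) U_g⋆`.
Hilbert spaces in this universe suffice for the norm of the full crossed product, as every cyclic
representation of `C_c(G, A)` lives on a completion of a quotient of `C_c(G, A)`. -/
structure CovariantRep (α : G →* (A ≃⋆ₐ[ℂ] A)) where
  H : Type (max u v)
  [normedAddCommGroup : NormedAddCommGroup H]
  [innerProductSpace : InnerProductSpace ℂ H]
  [completeSpace : CompleteSpace H]
  π : A →⋆ₐ[ℂ] (H →L[ℂ] H)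
  U : G →* unitary (H →L[ℂ] H)
  covariant : ∀ (g : G) (a : A),
    π (α g a) = (U g : H →L[ℂ] H) * π a * star (U g : H →L[ℂ] H)

attribute [instance] CovariantRep.normedAddCommGroup CovariantRep.innerProductSpace
  CovariantRep.completeSpace

namespace CovariantRep

variable {α : G →* (A ≃⋆ₐ[ℂ] A)} (ρ : CovariantRep α)

theorem U_mul_π (g : G) (a : A) :
    (ρ.U g : ρ.H →L[ℂ] ρ.H) * ρ.π a = ρ.π (α g a) * (ρ.U g : ρ.H →L[ℂ] ρ.H) := by
  rw [ρ.covariant, mul_assoc, Unitary.coe_star_mul_self, mul_one]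

/-- The underlying additive map of the integrated form of `ρ`. -/
def integratedAdd : ConvAlgebra α →+ (ρ.H →L[ℂ] ρ.H) :=
  ConvAlgebra.liftAdd α fun g =>
    (AddMonoidHom.mulRight (ρ.U g : ρ.H →L[ℂ] ρ.H)).comp (ρ.π : A →+ (ρ.H →L[ℂ] ρ.H))

theorem integratedAdd_single (g : G) (a : A) :
    ρ.integratedAdd (ConvAlgebra.single α g a) = ρ.π a * (ρ.U g : ρ.H →L[ℂ] ρ.H) :=
  ConvAlgebra.liftAdd_single α _ g a

/-- The integrated form `∑ a_g g ↦ ∑ π(a_g) U_g` of the covariant representation `ρ`, a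
`⋆`-representation of `C_c(G, A)`. -/
def integrated : ConvAlgebra α →⋆ₐ[ℂ] (ρ.H →L[ℂ] ρ.H) where
  toFun := ρ.integratedAdd
  map_one' := by rw [ConvAlgebra.one_def, integratedAdd_single]; simp
  map_zero' := map_zero _
  map_add' := map_add _
  map_mul' x y := by
    induction x using ConvAlgebra.induction_on with
    | h_zero => simp
    | h_add f g hf hg => rw [add_mul, map_add, map_add, hf, hg, add_mul]
    | h_single g a =>
      induction y using ConvAlgebra.induction_on with
      | h_zero => simp
      | h_add f g hf hg => rw [mul_add, map_add, map_add, hf, hg, mul_add]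
      | h_single h b =>
        rw [ConvAlgebra.single_mul_single]
        simp only [integratedAdd_single, map_mul, Submonoid.coe_mul]
        calc _ = ρ.π a * (ρ.π (α g b) * (ρ.U g : ρ.H →L[ℂ] ρ.H)) * ρ.U h := by
              simp only [mul_assoc]
          _ = _ := by rw [← U_mul_π]; simp only [mul_assoc]
  commutes' c := by
    rw [Algebra.algebraMap_eq_smul_one, ConvAlgebra.one_def, ConvAlgebra.smul_single,
      integratedAdd_single, map_smul]
    simp [Algebra.algebraMap_eq_smul_one]
  map_star' x := by
    induction x using ConvAlgebra.induction_on with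
    | h_zero => simp
    | h_add f g hf hg => simp only [star_add, map_add, hf, hg]
    | h_single g a =>
      rw [ConvAlgebra.star_single]
      simp only [integratedAdd_single]
      rw [← U_mul_π, star_mul, map_star, map_inv, ← Unitary.star_eq_inv, Unitary.coe_star]

theorem integrated_single (g : G) (a : A) :
    ρ.integrated (ConvAlgebra.single α g a) = ρ.π a * (ρ.U g : ρ.H →L[ℂ] ρ.H) :=
  ρ.integratedAdd_single g a

end CovariantRep

namespace ConvAlgebra

variable (α : G →* (A ≃⋆ₐ[ℂ] A))

/-- The universal norm on `C_c(G, A)`: the supremum of the operator norms over all covariant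
representations. -/
instance instNorm : Norm (ConvAlgebra α) := ⟨fun f => ⨆ ρ : CovariantRep α, ‖ρ.integrated f‖⟩

theorem norm_def (f : ConvAlgebra α) : ‖f‖ = ⨆ ρ : CovariantRep α, ‖ρ.integrated f‖ := rfl

theorem bddAbove (f : ConvAlgebra α) :
    BddAbove (Set.range fun ρ : CovariantRep α => ‖ρ.integrated f‖) := by
  suffices h : ∃ C : ℝ, ∀ ρ : CovariantRep α, ‖ρ.integrated f‖ ≤ C by
    obtain ⟨C, hC⟩ := h
    exact ⟨C, by rintro _ ⟨ρ, rfl⟩; exact hC ρ⟩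
  induction f using induction_on with
  | h_zero => exact ⟨0, fun ρ => by simp⟩
  | h_single g a =>
    refine ⟨‖a‖, fun ρ => ?_⟩
    rw [ρ.integrated_single, CStarRing.norm_mul_coe_unitary]
    exact NonUnitalStarAlgHom.norm_apply_le ρ.π a
  | h_add f g hf hg =>
    obtain ⟨C, hC⟩ := hf
    obtain ⟨D, hD⟩ := hg
    refine ⟨C + D, fun ρ => ?_⟩
    rw [map_add]
    exact (norm_add_le _ _).trans (add_le_add (hC ρ) (hD ρ))

variable {α}

theorem norm_integrated_le (ρ : CovariantRep α) (f : ConvAlgebra α) : ‖ρ.integrated f‖ ≤ ‖f‖ :=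
  le_ciSup (bddAbove α f) ρ

theorem norm_nonneg_aux (f : ConvAlgebra α) : 0 ≤ ‖f‖ :=
  Real.iSup_nonneg fun _ => norm_nonneg _

theorem norm_le_of_forall {f : ConvAlgebra α} {C : ℝ} (hC : 0 ≤ C)
    (h : ∀ ρ : CovariantRep α, ‖ρ.integrated f‖ ≤ C) : ‖f‖ ≤ C :=
  Real.iSup_le h hC

theorem norm_mul_le_aux (f g : ConvAlgebra α) : ‖f * g‖ ≤ ‖f‖ * ‖g‖ := by
  refine norm_le_of_forall (mul_nonneg (norm_nonneg_aux f) (norm_nonneg_aux g)) fun ρ => ?_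
  rw [map_mul]
  exact (norm_mul_le _ _).trans (mul_le_mul (norm_integrated_le ρ f) (norm_integrated_le ρ g)
    (norm_nonneg _) (norm_nonneg_aux f))

theorem norm_star_aux (f : ConvAlgebra α) : ‖star f‖ = ‖f‖ := by
  simp only [norm_def, map_star, norm_star]

theorem norm_smul_aux (c : ℂ) (f : ConvAlgebra α) : ‖c • f‖ ≤ ‖c‖ * ‖f‖ := by
  refine norm_le_of_forall (mul_nonneg (norm_nonneg c) (norm_nonneg_aux f)) fun ρ => ?_
  rw [map_smul, norm_smul]
  exact mul_le_mul_of_nonneg_left (norm_integrated_le ρ f) (norm_nonneg c)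

theorem norm_mul_self_le_aux (f : ConvAlgebra α) : ‖f‖ * ‖f‖ ≤ ‖star f * f‖ := by
  have h : ‖f‖ ≤ Real.sqrt ‖star f * f‖ := by
    refine norm_le_of_forall (Real.sqrt_nonneg _) fun ρ => Real.le_sqrt_of_sq_le ?_
    rw [pow_two, ← CStarRing.norm_star_mul_self, ← map_star, ← map_mul]
    exact norm_integrated_le ρ _
  calc ‖f‖ * ‖f‖ ≤ Real.sqrt ‖star f * f‖ * Real.sqrt ‖star f * f‖ :=
        mul_self_le_mul_self (norm_nonneg_aux f) h
    _ = _ := Real.mul_self_sqrt (norm_nonneg_aux _)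

variable (α)

/-- The universal norm, as a seminorm on the additive group `C_c(G, A)`. -/
def universalSeminorm : AddGroupSeminorm (ConvAlgebra α) where
  toFun f := ‖f‖
  map_zero' := by simp [norm_def]
  add_le' f g := by
    refine norm_le_of_forall (add_nonneg (norm_nonneg_aux f) (norm_nonneg_aux g)) fun ρ => ?_
    rw [map_add]
    exact (norm_add_le _ _).trans (add_le_add (norm_integrated_le ρ f) (norm_integrated_le ρ g))
  neg' f := by simp [norm_def]

instance instSeminormedRing : SeminormedRing (ConvAlgebra α) where
  __ := instNorm α
  __ := instRing α
  __ := (universalSeminorm α).toSeminormedAddCommGroup.toPseudoMetricSpace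
  dist_eq := (universalSeminorm α).toSeminormedAddCommGroup.dist_eq
  norm_mul_le := norm_mul_le_aux

instance instNormedAlgebra : NormedAlgebra ℂ (ConvAlgebra α) where
  __ := instAlgebra α
  norm_smul_le := norm_smul_aux

end ConvAlgebra

/-- The full crossed product `A ⋊ G`: the completion of `C_c(G, A)` in the universal norm. -/
def FullCrossedProduct (α : G →* (A ≃⋆ₐ[ℂ] A)) : Type (max u v) :=
  UniformSpace.Completion (ConvAlgebra α)

namespace FullCrossedProduct

open UniformSpace

variable (α : G →* (A ≃⋆ₐ[ℂ] A))

instance instNormedRing : NormedRing (FullCrossedProduct α) :=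
  inferInstanceAs (NormedRing (Completion (ConvAlgebra α)))

instance instCompleteSpace : CompleteSpace (FullCrossedProduct α) :=
  inferInstanceAs (CompleteSpace (Completion (ConvAlgebra α)))

instance instAlgebra : Algebra ℂ (FullCrossedProduct α) :=
  inferInstanceAs (Algebra ℂ (Completion (ConvAlgebra α)))

instance instNormedAlgebra : NormedAlgebra ℂ (FullCrossedProduct α) where
  __ := instAlgebra α
  norm_smul_le c x := norm_smul_le (β := Completion (ConvAlgebra α)) c x

/-- The canonical map of `C_c(G, A)` into its completion. -/
def of (f : ConvAlgebra α) : FullCrossedProduct α := (f : Completion (ConvAlgebra α))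

theorem norm_of (f : ConvAlgebra α) : ‖of α f‖ = ‖f‖ := Completion.norm_coe f

theorem of_add (f g : ConvAlgebra α) : of α (f + g) = of α f + of α g := Completion.coe_add f g

theorem of_mul (f g : ConvAlgebra α) : of α (f * g) = of α f * of α g := Completion.coe_mul f g

theorem of_one : of α 1 = 1 := rfl

theorem of_zero : of α 0 = 0 := rfl

theorem of_smul (c : ℂ) (f : ConvAlgebra α) : of α (c • f) = c • of α f :=
  Completion.coe_smul c f

theorem continuous_of : Continuous (of α) := Completion.continuous_coe _

theorem denseRange_of : DenseRange (of α) := Completion.denseRange_coe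

/-- The involution of the crossed product extends that of `C_c(G, A)` by continuity. -/
instance instStar : Star (FullCrossedProduct α) :=
  ⟨Completion.map (star : ConvAlgebra α → ConvAlgebra α)⟩

theorem isometry_star : Isometry (star : ConvAlgebra α → ConvAlgebra α) :=
  AddMonoidHomClass.isometry_of_norm (ConvAlgebra.starHom α) ConvAlgebra.norm_star_aux

theorem continuous_star_aux : Continuous (star : FullCrossedProduct α → FullCrossedProduct α) :=
  Completion.continuous_map

theorem star_of (f : ConvAlgebra α) : star (of α f) = of α (star f) :=
  Completion.map_coe (isometry_star α).uniformContinuous f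

instance instStarRing : StarRing (FullCrossedProduct α) where
  star_involutive x := by
    have hc := continuous_star_aux α
    refine (denseRange_of α).induction_on x
      (isClosed_eq (hc.comp hc) continuous_id) fun f => ?_
    rw [star_of, star_of, star_star]
  star_mul x y := by
    have hc := continuous_star_aux α
    refine (denseRange_of α).induction_on₂
      (p := fun x y : FullCrossedProduct α => star (x * y) = star y * star x)
      (isClosed_eq (hc.comp (continuous_fst.mul continuous_snd))
        ((hc.comp continuous_snd).mul (hc.comp continuous_fst))) (fun f g => ?_) x y
    rw [← of_mul, star_of, star_of, star_of, star_mul, of_mul]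
  star_add x y := by
    have hc := continuous_star_aux α
    refine (denseRange_of α).induction_on₂
      (p := fun x y : FullCrossedProduct α => star (x + y) = star x + star y)
      (isClosed_eq (hc.comp (continuous_fst.add continuous_snd))
        ((hc.comp continuous_fst).add (hc.comp continuous_snd))) (fun f g => ?_) x y
    rw [← of_add, star_of, star_of, star_of, star_add, of_add]

instance instCStarRing : CStarRing (FullCrossedProduct α) where
  norm_mul_self_le x := by
    have hc := continuous_star_aux α
    refine (denseRange_of α).induction_on x
      (isClosed_le (continuous_norm.mul continuous_norm)
        (continuous_norm.comp (hc.mul continuous_id))) fun f => ?_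
    rw [star_of, ← of_mul, norm_of, norm_of]
    exact ConvAlgebra.norm_mul_self_le_aux f

instance instStarModule : StarModule ℂ (FullCrossedProduct α) where
  star_smul c x := by
    have hc := continuous_star_aux α
    refine (denseRange_of α).induction_on x
      (isClosed_eq (hc.comp (continuous_const_smul c)) (hc.const_smul (star c))) fun f => ?_
    rw [← of_smul, star_of, star_of, star_smul, of_smul]

instance instCStarAlgebra : CStarAlgebra (FullCrossedProduct α) where
  __ := instNormedRing α
  __ := instStarRing α
  __ := instCompleteSpace α
  __ := instCStarRing α
  __ := instNormedAlgebra α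
  __ := instStarModule α

/-- The order of the C⋆-algebra `A ⋊ G`, whose positive elements are the `x⋆ x`. -/
instance instPartialOrder : PartialOrder (FullCrossedProduct α) := CStarAlgebra.spectralOrder _

instance instStarOrderedRing : StarOrderedRing (FullCrossedProduct α) :=
  CStarAlgebra.spectralOrderedRing _

/-- The canonical inclusion `A ⊆ A ⋊ G`, sending `a` to the function `a e` supported at the
identity `e` of `G`. -/
def incl : A →⋆ₐ[ℂ] FullCrossedProduct α where
  toFun a := of α (ConvAlgebra.single α 1 a)
  map_one' := rfl
  map_mul' a b := by
    rw [← of_mul, ConvAlgebra.single_mul_single, ConvAlgebra.act_one, one_mul]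
  map_zero' := by rw [ConvAlgebra.single_zero, of_zero]
  map_add' a b := by rw [ConvAlgebra.single_add, of_add]
  commutes' c := by
    rw [Algebra.algebraMap_eq_smul_one, ← ConvAlgebra.smul_single, of_smul,
      Algebra.algebraMap_eq_smul_one]
    rfl
  map_star' a := by
    rw [star_of, ConvAlgebra.star_single, inv_one, ConvAlgebra.act_one]

end FullCrossedProduct

end Dynamics

end

/-! Write `u_g` for the function with value `1` at `g` and `0` elsewhere. Evaluation `f ↦ f(e)`
always extends to a conditional expectation on `A ⋊ G`: compressing the regular representation
induced by `π` to the copy of `H` at `e` gives `π(f(e))`, so the evaluation is contractive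
(`ConvAlgebra.norm_coeffOne_le`), and its complete positivity can be checked on finitely supported
functions. The question is thus whether this expectation is the only one.

Any conditional expectation `E` is an `A`-bimodule map (`IsConditionalExpectation.map_incl_mul`,
`map_mul_incl`). Applied to `u_g a = α_g(a) u_g`, this makes `E(u_g)` a dependent element for `α_g`.
A free action therefore forces `E(u_g) = 0` for `g ≠ e`, which determines `E` on a dense subspace.

Conversely, a dependent element `b` for `α_g` with `g ≠ e` yields `w = b⋆ u_g` in the relative
commutant of `A`, with `w⋆ w` in `A`. Compressing the canonical expectation by `1 + t w`, `|t| = 1`,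
and normalising gives further expectations (`IsConditionalExpectation.exists_compression`). If they
all coincide with the canonical one, comparing `t = 1` and `t = i` gives `w⋆ w = 0`, hence `b = 0`.
-/

open scoped CStarAlgebra

noncomputable section

/-! ### States and the norm of GNS representations -/

section States

variable {A : Type*} [CStarAlgebra A] [PartialOrder A] [StarOrderedRing A]

-- Expanding `|f(x + it)|² ≤ ‖x + it‖² ≤ ‖x‖² + t²` for real `t`, the terms `t²` cancel. What is
-- left is linear in `t`, and it fails for a suitable `t` unless `Im f(x) = 0`.
omit [PartialOrder A] [StarOrderedRing A] in
theorem im_apply_eq_zero_of_isSelfAdjoint {f : A →L[ℂ] ℂ} (hf : ‖f‖ ≤ 1) (hf1 : f 1 = 1)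
    {x : A} (hx : IsSelfAdjoint x) : (f x).im = 0 := by
  have : Nontrivial A := ⟨1, 0, fun h => by simp [h] at hf1⟩
  have key (t : ℝ) : (f x).im ^ 2 + 2 * (f x).im * t ≤ ‖x‖ ^ 2 := by
    have h1 : ‖f (x + (t * Complex.I : ℂ) • 1)‖ ≤ ‖x + (t * Complex.I : ℂ) • 1‖ :=
      (f.le_opNorm _).trans (mul_le_of_le_one_left (norm_nonneg _) hf)
    have h2 : star (x + (t * Complex.I : ℂ) • (1 : A)) * (x + (t * Complex.I : ℂ) • 1)
        = x * x + ((t ^ 2 : ℝ) : ℂ) • 1 := by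
      have hc : ((t : ℂ) * Complex.I) * (t * Complex.I) = -(t ^ 2 : ℝ) := by
        push_cast
        linear_combination (t : ℂ) ^ 2 * Complex.I_mul_I
      have hs : star ((t : ℂ) * Complex.I) = -(t * Complex.I) := by simp
      rw [star_add, hx.star_eq, star_smul, star_one, hs]
      generalize (t : ℂ) * Complex.I = c at hc
      have : ((t ^ 2 : ℝ) : ℂ) = -(c * c) := by rw [hc, neg_neg]
      rw [this]
      simp only [add_mul, mul_add, smul_mul_assoc, mul_smul_comm, one_mul, mul_one]
      module
    have h3 : ‖x + (t * Complex.I : ℂ) • (1 : A)‖ ^ 2 ≤ ‖x‖ ^ 2 + t ^ 2 := by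
      rw [pow_two, ← CStarRing.norm_star_mul_self, h2]
      refine (norm_add_le _ _).trans (add_le_add ((norm_mul_le _ _).trans_eq (pow_two _).symm) ?_)
      rw [norm_smul]
      simp
    have h4 : ‖f (x + (t * Complex.I : ℂ) • 1)‖ ^ 2 = (f x).re ^ 2 + ((f x).im + t) ^ 2 := by
      rw [map_add, map_smul, hf1, Complex.sq_norm, Complex.normSq_apply]
      simp
      ring
    have h5 := pow_le_pow_left₀ (norm_nonneg _) h1 2
    nlinarith [sq_nonneg (f x).re]
  by_contra h
  have := key ((‖x‖ ^ 2 + 1) / (2 * (f x).im))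
  have h6 : 2 * (f x).im * ((‖x‖ ^ 2 + 1) / (2 * (f x).im)) = ‖x‖ ^ 2 + 1 := by
    field_simp
  rw [h6] at this
  nlinarith [sq_nonneg (f x).im]

-- For `x ≥ 0` the element `‖x‖ - x` has norm at most `‖x‖`, so the real number `f(x)` lies within
-- `‖x‖` of `‖x‖`.
open scoped ComplexOrder in
theorem apply_nonneg_of_norm_le_one {f : A →L[ℂ] ℂ} (hf : ‖f‖ ≤ 1) (hf1 : f 1 = 1)
    {x : A} (hx : 0 ≤ x) : 0 ≤ f x := by
  have him := im_apply_eq_zero_of_isSelfAdjoint hf hf1 (IsSelfAdjoint.of_nonneg hx)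
  refine Complex.nonneg_iff.2 ⟨?_, him.symm⟩
  have h1 : ‖algebraMap ℝ A ‖x‖ - x‖ ≤ ‖x‖ := by
    have h2 : algebraMap ℝ A ‖x‖ - x ≤ algebraMap ℝ A ‖x‖ := sub_le_self _ hx
    have h3 : 0 ≤ algebraMap ℝ A ‖x‖ - x :=
      sub_nonneg.2 (IsSelfAdjoint.le_algebraMap_norm_self (.of_nonneg hx))
    exact (CStarAlgebra.norm_le_iff_le_algebraMap _ (norm_nonneg x) h3).2 h2
  have h2 : ‖f (algebraMap ℝ A ‖x‖ - x)‖ ≤ ‖x‖ :=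
    ((f.le_opNorm _).trans (mul_le_of_le_one_left (norm_nonneg _) hf)).trans h1
  have h3 : f (algebraMap ℝ A ‖x‖ - x) = ‖x‖ - f x := by
    rw [map_sub, Algebra.algebraMap_eq_smul_one, ← Complex.coe_smul, map_smul, hf1]
    simp
  rw [h3] at h2
  have h4 := (Complex.re_le_norm _).trans h2
  simp at h4
  exact h4

open scoped ComplexOrder in
/-- Every element of a C⋆-algebra is normed by the GNS representation of some state. -/
theorem exists_le_norm_gnsStarAlgHom (a : A) :
    ∃ f : A →ₚ[ℂ] ℂ, ‖a‖ ≤ ‖f.gnsStarAlgHom a‖ := by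
  rcases eq_or_ne a 0 with rfl | ha
  -- `A` may be the zero algebra, which has no state; the zero functional serves here.
  · exact ⟨0, by simp⟩
  have : Nontrivial A := ⟨a, 0, ha⟩
  have hn : 0 < ‖a‖ := norm_pos_iff.2 ha
  -- Since `h ≥ 0` and `‖h‖ = 1`, the norm of `1 + h` is `2`. A functional of norm one attaining it
  -- must take the value `1` at both `1` and `h`: it is a state with `f(a⋆ a) = ‖a‖²`, so its cyclic
  -- vector norms `a`.
  set h : A := ((‖a‖ ^ 2)⁻¹ : ℝ) • (star a * a) with hh
  have h0 : 0 ≤ h := smul_nonneg (by positivity) (star_mul_self_nonneg a)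
  have h1 : ‖h‖ = 1 := by
    rw [hh, norm_smul, CStarRing.norm_star_mul_self, Real.norm_of_nonneg (by positivity)]
    field_simp
  have h2 : ‖1 + h‖ = 2 := by
    refine le_antisymm ((norm_add_le _ _).trans (by rw [h1, norm_one]; norm_num)) ?_
    have h3 : ‖h‖ + 1 ∈ spectrum ℝ (1 + h) := by
      have := spectrum.add_mem_add_iff (R := ℝ) (a := h) (r := ‖h‖) (s := 1)
      rw [map_one] at this
      exact this.2 (CStarAlgebra.norm_mem_spectrum_of_nonneg h0)
    have h4 := spectrum.norm_le_norm_of_mem h3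
    rw [h1] at h4
    norm_num at h4
    exact h4
  obtain ⟨f, hf, hfh⟩ := exists_dual_vector ℂ (1 + h) (by rw [h2]; norm_num)
  have hre (x : A) (hx : ‖x‖ = 1) : ‖f x‖ ≤ 1 := by
    simpa [hf, hx] using f.le_opNorm x
  have hsum : f 1 + f h = 2 := by rw [← map_add, hfh, h2]; norm_num
  have hre1 := hre 1 norm_one
  have hreh := hre h h1
  have aux : ∀ z w : ℂ, ‖z‖ ≤ 1 → ‖w‖ ≤ 1 → z + w = 2 → z = 1 := by
    intro z w hz hw hzw
    have hre : z.re = 1 := by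
      have h3 := (Complex.re_le_norm z).trans hz
      have h4 := (Complex.re_le_norm w).trans hw
      have h5 : z.re + w.re = 2 := by simpa using congrArg Complex.re hzw
      linarith
    have him : z.im = 0 := by
      have h3 : ‖z‖ ^ 2 ≤ 1 := pow_le_one₀ (norm_nonneg _) hz
      rw [Complex.sq_norm, Complex.normSq_apply, hre] at h3
      nlinarith
    exact Complex.ext (by simpa using hre) (by simpa using him)
  have hf1 : f 1 = 1 := aux _ _ hre1 hreh hsum
  have hfh1 : f h = 1 := aux _ _ hreh hre1 (by rw [add_comm]; exact hsum)
  let φ : A →ₚ[ℂ] ℂ := PositiveLinearMap.mk₀ (f : A →ₗ[ℂ] ℂ)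
    fun x hx => apply_nonneg_of_norm_le_one hf.le hf1 hx
  have hφ (x : A) : φ x = f x := rfl
  have hfa : f (star a * a) = (‖a‖ ^ 2 : ℝ) := by
    have : star a * a = ((‖a‖ ^ 2 : ℝ) : ℂ) • h := by
      rw [hh, Complex.coe_smul, smul_smul, mul_inv_cancel₀ (by positivity), one_smul]
    rw [this, map_smul, hfh1]
    simp
  refine ⟨φ, ?_⟩
  have hξ : ‖((φ.toPreGNS 1 : φ.PreGNS) : φ.GNS)‖ = 1 := by
    rw [UniformSpace.Completion.norm_coe, φ.preGNS_norm_def]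
    simp [hφ, hf1]
  have haξ : ‖φ.gnsStarAlgHom a ((φ.toPreGNS 1 : φ.PreGNS) : φ.GNS)‖ = ‖a‖ := by
    change ‖φ.gnsNonUnitalStarAlgHom a _‖ = _
    rw [PositiveLinearMap.gnsNonUnitalStarAlgHom_apply_coe,
      UniformSpace.Completion.norm_coe, φ.preGNS_norm_def]
    simp [hφ, hfa, -Complex.ofReal_pow]
  calc ‖a‖ = _ := haξ.symm
    _ ≤ _ := (φ.gnsStarAlgHom a).le_opNorm _
    _ = _ := by rw [hξ, mul_one]

end States

/-! ### Regular representations and contractivity of `f ↦ f(e)` -/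

section Regular
universe u v
variable {A : Type u} {G : Type v} [CStarAlgebra A] [Group G]
open scoped ENNReal

theorem Memℓp.comp_mul_left {H : Type*} [NormedAddCommGroup H] {η : G → H}
    (hη : Memℓp (E := fun _ => H) η 2) (g : G) :
    Memℓp (E := fun _ => H) (fun k => η (g * k)) 2 := by
  have h := hη.summable (by norm_num)
  exact memℓp_gen (h.comp_injective (mul_right_injective g))

/-- The permutation of `ℓ²(G, H)` induced by left translation by `g`. -/
def lpTranslation {H : Type*} [NormedAddCommGroup H] [InnerProductSpace ℂ H] (g : G) :
    lp (fun _ : G => H) 2 ≃ₗᵢ[ℂ] lp (fun _ : G => H) 2 where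
  toFun η := ⟨fun k => η (g⁻¹ * k), (lp.memℓp η).comp_mul_left g⁻¹⟩
  invFun η := ⟨fun k => η (g * k), (lp.memℓp η).comp_mul_left g⟩
  map_add' _ _ := rfl
  map_smul' _ _ := rfl
  left_inv η := lp.ext <| funext fun k => congrArg η (inv_mul_cancel_left g k)
  right_inv η := lp.ext <| funext fun k => congrArg η (mul_inv_cancel_left g k)
  norm_map' η := by
    rw [lp.norm_eq_tsum_rpow (by norm_num), lp.norm_eq_tsum_rpow (by norm_num)]
    congr 1
    exact (Equiv.mulLeft g⁻¹).tsum_eq (fun k => ‖η k‖ ^ (2 : ℝ≥0∞).toReal)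

theorem lpTranslation_apply {H : Type*} [NormedAddCommGroup H] [InnerProductSpace ℂ H] (g : G)
    (η : lp (fun _ : G => H) 2) (k : G) : lpTranslation g η k = η (g⁻¹ * k) := rfl

/-- The regular covariant representation on `ℓ²(G, H)` induced by a representation of `A`
on `H`. -/
def CovariantRep.regular (α : G →* (A ≃⋆ₐ[ℂ] A)) {H : Type u} [NormedAddCommGroup H]
    [InnerProductSpace ℂ H] [CompleteSpace H] (π : A →⋆ₐ[ℂ] (H →L[ℂ] H)) : CovariantRep α where
  H := lp (fun _ : G => H) 2
  π :=
    { toFun := fun a => lp.mapCLM 2 (fun k => π (α k⁻¹ a)) (norm_nonneg a) fun k =>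
        (NonUnitalStarAlgHom.norm_apply_le π _).trans (NonUnitalStarAlgHom.norm_apply_le (α k⁻¹) a)
      map_one' := by ext η k; simp
      map_mul' := fun a b => by ext η k; simp
      map_zero' := by ext η k; simp
      map_add' := fun a b => by ext η k; simp
      commutes' := fun c => by ext η k; simp [Algebra.algebraMap_eq_smul_one]
      map_star' := fun a => by
        refine (ContinuousLinearMap.eq_adjoint_iff _ _).2 fun η ζ => ?_
        rw [lp.inner_eq_tsum, lp.inner_eq_tsum]
        refine tsum_congr fun k => ?_
        change inner ℂ (π (α k⁻¹ (star a)) (η k)) (ζ k) = inner ℂ (η k) (π (α k⁻¹ a) (ζ k))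
        rw [map_star, map_star, ContinuousLinearMap.star_eq_adjoint,
          ContinuousLinearMap.adjoint_inner_left] }
  U :=
    { toFun := fun g => Unitary.linearIsometryEquiv.symm (lpTranslation g)
      map_one' := by
        ext η k
        simp [lpTranslation_apply]
      map_mul' := fun g h => by
        ext η k
        simp [lpTranslation_apply, mul_assoc] }
  covariant g a := by
    -- Covariance is proved in the form `π(α_g(a)) U_g = U_g π(a)` and then multiplied on the right
    -- by `U_g⋆`.
    refine Eq.trans ?_ (congrArg (· * _) (?_ : lp.mapCLM 2 (fun k => π (α k⁻¹ (α g a)))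
      (norm_nonneg (α g a)) (fun k => (NonUnitalStarAlgHom.norm_apply_le π _).trans
        (NonUnitalStarAlgHom.norm_apply_le (α k⁻¹) _)) *
      ((Unitary.linearIsometryEquiv.symm (lpTranslation g) :
        unitary (lp (fun _ : G => H) 2 →L[ℂ] lp (fun _ : G => H) 2)) :
        lp (fun _ : G => H) 2 →L[ℂ] lp (fun _ : G => H) 2) = _))
    · rw [mul_assoc]
      exact ((congrArg _ (Unitary.coe_mul_star_self _)).trans (mul_one _)).symm
    · ext η k
      change π (α k⁻¹ (α g a)) (η (g⁻¹ * k)) = π (α (g⁻¹ * k)⁻¹ a) (η (g⁻¹ * k))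
      rw [mul_inv_rev, inv_inv, ConvAlgebra.act_mul]

/-- The evaluation `f ↦ f(e)` of a finitely supported function at the identity. -/
def ConvAlgebra.coeffOne (α : G →* (A ≃⋆ₐ[ℂ] A)) : ConvAlgebra α →ₗ[ℂ] A :=
  open scoped Classical in
  { liftAdd α fun g => if g = 1 then AddMonoidHom.id A else 0 with
    map_smul' := fun c f => by
      change liftAdd α _ (c • f) = c • liftAdd α _ f
      induction f using induction_on with
      | h_zero => simp
      | h_single g a =>
        rw [smul_single, liftAdd_single, liftAdd_single]
        split_ifs <;> simp
      | h_add f g hf hg =>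
        rw [smul_add, map_add, map_add, smul_add]
        exact congrArg₂ (· + ·) hf hg }

theorem ConvAlgebra.coeffOne_single_one (α : G →* (A ≃⋆ₐ[ℂ] A)) (a : A) :
    coeffOne α (single α 1 a) = a := by
  change liftAdd α _ _ = _
  rw [liftAdd_single]
  simp

theorem ConvAlgebra.coeffOne_single_of_ne (α : G →* (A ≃⋆ₐ[ℂ] A)) {g : G} (hg : g ≠ 1) (a : A) :
    coeffOne α (single α g a) = 0 := by
  change liftAdd α _ _ = _
  rw [liftAdd_single]
  simp [hg]

-- `U_g` moves a vector supported at `e` to one supported at `g`, so only the term `g = e` reaches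
-- the coordinate `e`, where the twist `α_{e⁻¹}` is trivial.
open scoped Classical in
theorem CovariantRep.regular_integrated_single_one (α : G →* (A ≃⋆ₐ[ℂ] A)) {H : Type u}
    [NormedAddCommGroup H] [InnerProductSpace ℂ H] [CompleteSpace H] (π : A →⋆ₐ[ℂ] (H →L[ℂ] H))
    (f : ConvAlgebra α) (ξ : H) :
    (show lp (fun _ : G => H) 2 from
      (regular α π).integrated f (lp.single 2 1 ξ : lp (fun _ : G => H) 2)) 1 = π (ConvAlgebra.coeffOne α f) ξ := by
  induction f using ConvAlgebra.induction_on with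
  | h_zero => rw [map_zero, map_zero, map_zero]; rfl
  | h_add f g hf hg =>
    rw [map_add, map_add, map_add]
    exact congrArg₂ (· + ·) hf hg
  | h_single g a =>
    rw [integrated_single]
    change π (α (1 : G)⁻¹ a) (lp.single (E := fun _ : G => H) 2 1 ξ (g⁻¹ * 1)) = _
    rw [inv_one, ConvAlgebra.act_one, mul_one]
    by_cases hg : g = 1
    · subst hg
      rw [inv_one, lp.single_apply_self, ConvAlgebra.coeffOne_single_one]
    · rw [lp.single_apply_ne _ _ _ (by simpa using hg), ConvAlgebra.coeffOne_single_of_ne α hg]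
      simp

/-- `π(f(e))` is a corner of the regular representation of `f`; take for `π` a GNS representation
that norms `f(e)`. Its space lies in the universe of `A`, as `CovariantRep.regular` requires. -/
theorem ConvAlgebra.norm_coeffOne_le (α : G →* (A ≃⋆ₐ[ℂ] A)) (f : ConvAlgebra α) :
    ‖coeffOne α f‖ ≤ ‖f‖ := by
  classical
  let := CStarAlgebra.spectralOrder A
  have := CStarAlgebra.spectralOrderedRing A
  obtain ⟨φ, hφ⟩ := exists_le_norm_gnsStarAlgHom (coeffOne α f)
  refine hφ.trans ((ContinuousLinearMap.opNorm_le_bound _ (norm_nonneg _) fun ξ => ?_).trans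
    (norm_integrated_le (CovariantRep.regular α φ.gnsStarAlgHom) f))
  rw [← CovariantRep.regular_integrated_single_one]
  refine (lp.norm_apply_le_norm two_ne_zero _ _).trans
    ((ContinuousLinearMap.le_opNorm _ _).trans_eq ?_)
  congr 1
  exact lp.norm_single (E := fun _ : G => φ.GNS) (by norm_num) 1 ξ

end Regular

/-! ### Positive matrices over a C⋆-algebra -/

section MatrixPositivity

variable {B : Type*} [CStarAlgebra B] [PartialOrder B] [StarOrderedRing B]
variable {n : Type*} [Fintype n]

omit [Fintype n] in
theorem CStarMatrix.sum_apply {ι C : Type*} [AddCommMonoid C] (S : Finset ι)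
    (M : ι → CStarMatrix n n C) (i j : n) : (∑ l ∈ S, M l) i j = ∑ l ∈ S, M l i j :=
  Matrix.sum_apply i j S M

omit [Fintype n] in
theorem CStarMatrix.ofMatrix_of_apply {C : Type*} (f : n → n → C) (i j : n) :
    ofMatrix (.of f) i j = f i j := rfl

theorem NonUnitalCStarAlgebra.nonneg_iff_exists_eq_star_mul_self {C : Type*}
    [NonUnitalCStarAlgebra C] [PartialOrder C] [StarOrderedRing C] {a : C} :
    0 ≤ a ↔ ∃ b, a = star b * b :=
  CStarAlgebra.nonneg_iff_eq_star_mul_self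

theorem CStarMatrix.nonneg_iff_exists {M : CStarMatrix n n B} :
    0 ≤ M ↔ ∃ N : CStarMatrix n n B, ∀ i j, M i j = ∑ l, star (N l i) * N l j := by
  rw [NonUnitalCStarAlgebra.nonneg_iff_exists_eq_star_mul_self]
  refine exists_congr fun N => ?_
  rw [← CStarMatrix.ext_iff]
  rfl

theorem CStarMatrix.nonneg_ofMatrix_star_mul (v : n → B) :
    0 ≤ ofMatrix (.of fun i j => star (v i) * v j) := by
  classical
  rcases isEmpty_or_nonempty n with h | ⟨⟨i₀⟩⟩
  · exact le_of_eq (CStarMatrix.ext fun i => h.elim i)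
  -- The factor `N` has `v` as its row `i₀` and zero rows elsewhere.
  · refine CStarMatrix.nonneg_iff_exists.2 ⟨ofMatrix (.of fun l j => if l = i₀ then v j else 0),
      fun i j => ?_⟩
    simp only [ofMatrix_of_apply]
    rw [Finset.sum_eq_single i₀] <;> simp +contextual

theorem CStarMatrix.nonneg_map_conj {M : CStarMatrix n n B} (hM : 0 ≤ M) (h : B) :
    0 ≤ M.map fun x => star h * x * h := by
  obtain ⟨N, hN⟩ := CStarMatrix.nonneg_iff_exists.1 hM
  refine CStarMatrix.nonneg_iff_exists.2 ⟨N.map (· * h), fun i j => ?_⟩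
  simp only [CStarMatrix.map_apply, hN, Finset.mul_sum, Finset.sum_mul, star_mul, mul_assoc]

/-- With `M = N⋆ N` the double sum is `∑ y_l⋆ y_l`, where `y = N c`. -/
theorem CStarMatrix.sum_conj_nonneg {M : CStarMatrix n n B} (hM : 0 ≤ M) (c : n → B) :
    0 ≤ ∑ i, ∑ j, star (c i) * M i j * c j := by
  obtain ⟨N, hN⟩ := CStarMatrix.nonneg_iff_exists.1 hM
  have : ∑ i, ∑ j, star (c i) * M i j * c j
      = ∑ l, star (∑ i, N l i * c i) * ∑ j, N l j * c j := by
    simp only [hN, star_sum, Finset.sum_mul_sum]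
    symm
    rw [Finset.sum_comm]
    refine Finset.sum_congr rfl fun i _ => ?_
    rw [Finset.sum_comm]
    simp only [Finset.mul_sum, Finset.sum_mul, star_mul, mul_assoc]
  rw [this]
  exact Finset.sum_nonneg fun l _ => star_mul_self_nonneg _

end MatrixPositivity

/-! ### The canonical conditional expectation -/

section CanonicalExpectation
universe u v
variable {A : Type u} {G : Type v} [CStarAlgebra A] [Group G] (α : G →* (A ≃⋆ₐ[ℂ] A))

theorem ConvAlgebra.exists_eq_sum_single (f : ConvAlgebra α) :
    ∃ a : G →₀ A, f = a.sum fun g b => single α g b := by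
  classical
  induction f using induction_on with
  | h_zero => exact ⟨0, by simp⟩
  | h_single g a => exact ⟨Finsupp.single g a, by simp [single_zero]⟩
  | h_add f g hf hg =>
    obtain ⟨a, rfl⟩ := hf
    obtain ⟨b, rfl⟩ := hg
    exact ⟨a + b, (Finsupp.sum_add_index' (single_zero α) (single_add α)).symm⟩

/-- The product of `(a_g g)⋆` and `b_h h` is supported at `g⁻¹ h`, so only the diagonal `g = h`
contributes at `e`. -/
theorem ConvAlgebra.coeffOne_star_mul_sum_single (S : Finset G) (a b : G → A) :
    coeffOne α (star (∑ g ∈ S, single α g (a g)) * ∑ g ∈ S, single α g (b g))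
      = ∑ g ∈ S, star (α g⁻¹ (a g)) * α g⁻¹ (b g) := by
  simp only [star_sum, Finset.sum_mul, Finset.mul_sum, map_sum, star_single, single_mul_single]
  rw [Finset.sum_comm]
  refine Finset.sum_congr rfl fun g hg => ?_
  rw [Finset.sum_eq_single_of_mem g hg, inv_mul_cancel, coeffOne_single_one, map_star]
  intro h _ hne
  exact coeffOne_single_of_ne α (fun he => hne (inv_mul_eq_one.1 he).symm) _

namespace FullCrossedProduct

/-- The canonical map of `C_c(G, A)` into its completion, as a linear map. -/
def ofₗ : ConvAlgebra α →ₗ[ℂ] FullCrossedProduct α where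
  toFun := of α
  map_add' := of_add α
  map_smul' := of_smul α

/-- The canonical expectation, which extends `f ↦ f(e)` to `A ⋊ G`. -/
def expectationL : FullCrossedProduct α →L[ℂ] A := (ConvAlgebra.coeffOne α).extendOfNorm (ofₗ α)

theorem expectationL_of (f : ConvAlgebra α) :
    expectationL α (of α f) = ConvAlgebra.coeffOne α f :=
  LinearMap.extendOfNorm_eq (e := ofₗ α) (denseRange_of α) ⟨1, fun f => by
    rw [one_mul]
    exact (ConvAlgebra.norm_coeffOne_le α f).trans_eq (norm_of α f).symm⟩ f

variable [PartialOrder A] [StarOrderedRing A]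

/-- The positive cone is closed, so by density the `v i` may be taken finitely supported. The matrix
is then a sum over `g` of matrices `(x_i⋆ x_j)` with `x_i = α_{g⁻¹}(v_i(g))`. -/
theorem nonneg_ofMatrix_expectationL {n : Type*} [Fintype n] (v : n → FullCrossedProduct α) :
    0 ≤ CStarMatrix.ofMatrix (.of fun i j => expectationL α (star (v i) * v j)) := by
  classical
  have hd : DenseRange (Pi.map fun (_ : n) => of α) :=
    DenseRange.piMap fun _ => denseRange_of α
  refine hd.induction_on v ?_ fun f => ?_
  · have hc : Continuous fun v : n → FullCrossedProduct α =>
        CStarMatrix.ofMatrix (.of fun i j => expectationL α (star (v i) * v j)) := by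
      refine continuous_pi fun i => continuous_pi fun j => ?_
      exact (expectationL α).continuous.comp
        ((continuous_star.comp (continuous_apply i)).mul (continuous_apply j))
    exact isClosed_Ici.preimage hc
  -- All `f i` are written over one common finite support `S`.
  · choose a ha using fun i => ConvAlgebra.exists_eq_sum_single α (f i)
    set S := Finset.univ.biUnion fun i => (a i).support
    have hf (i : n) : f i = ∑ g ∈ S, ConvAlgebra.single α g (a i g) := by
      rw [ha i]
      exact Finsupp.sum_of_support_subset _
        (Finset.subset_biUnion_of_mem (fun i => (a i).support) (Finset.mem_univ i)) _
        fun g _ => ConvAlgebra.single_zero α g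
    have h (i j : n) : expectationL α (star (of α (f i)) * of α (f j))
        = ∑ g ∈ S, star (α g⁻¹ (a i g)) * α g⁻¹ (a j g) := by
      rw [star_of, ← of_mul, expectationL_of, hf, hf, ConvAlgebra.coeffOne_star_mul_sum_single]
    have h' : CStarMatrix.ofMatrix (.of fun i j => expectationL α (star (of α (f i)) * of α (f j)))
        = ∑ g ∈ S, CStarMatrix.ofMatrix
          (.of fun i j => star (α g⁻¹ (a i g)) * α g⁻¹ (a j g)) := by
      refine CStarMatrix.ext fun i j => ?_
      rw [CStarMatrix.sum_apply]
      exact h i j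
    exact h'.symm ▸ Finset.sum_nonneg fun g _ => CStarMatrix.nonneg_ofMatrix_star_mul _

/-- The canonical conditional expectation of `A ⋊ G` onto `A`. -/
def expectation : FullCrossedProduct α →CP A where
  toLinearMap := expectationL α
  map_cstarMatrix_nonneg' k M hM := by
    obtain ⟨N, hN⟩ := CStarMatrix.nonneg_iff_exists.1 hM
    -- Writing `M = N⋆ N`, each row of `N` contributes one matrix of the kind just treated.
    have : M.map (expectationL α) = ∑ l, CStarMatrix.ofMatrix
        (.of fun i j => expectationL α (star (N l i) * N l j)) := by
      refine CStarMatrix.ext fun i j => ?_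
      rw [CStarMatrix.map_apply, hN, map_sum, CStarMatrix.sum_apply]
      rfl
    change 0 ≤ M.map (expectationL α)
    rw [this]
    exact Finset.sum_nonneg fun l _ => nonneg_ofMatrix_expectationL α (N l)

theorem expectation_of (f : ConvAlgebra α) :
    expectation α (of α f) = ConvAlgebra.coeffOne α f := expectationL_of α f

theorem isConditionalExpectation_expectation :
    IsConditionalExpectation (incl α) (expectation α) where
  map_one := (expectation_of α _).trans (ConvAlgebra.coeffOne_single_one α 1)
  map_incl a := (expectation_of α _).trans (ConvAlgebra.coeffOne_single_one α a)

end FullCrossedProduct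

end CanonicalExpectation

/-! ### Kadison–Schwarz, multiplicative domains and the bimodule property -/

section MultiplicativeDomain

variable {A B : Type*} [CStarAlgebra A] [PartialOrder A] [StarOrderedRing A]
  [CStarAlgebra B] [PartialOrder B] [StarOrderedRing B]

/-- The Kadison–Schwarz inequality for unital completely positive maps. -/
theorem CompletelyPositiveMap.star_map_mul_map_le (E : B →CP A) (h1 : E 1 = 1) (x : B) :
    star (E x) * E x ≤ E (star x * x) := by
  -- The positive matrix with rows `(1, x)` and `(x⋆, x⋆ x)` is mapped entrywise by `E` and
  -- evaluated at the vector `(-E x, 1)`.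
  have h := CStarMatrix.nonneg_ofMatrix_star_mul ![1, x]
  have h2 := CStarMatrix.sum_conj_nonneg (E.map_cstarMatrix_nonneg _ h) ![-E x, 1]
  simp only [Fin.sum_univ_two, CStarMatrix.map_apply, CStarMatrix.ofMatrix_of_apply,
    Matrix.cons_val_zero, Matrix.cons_val_one, star_one, one_mul, mul_one, star_neg, neg_mul,
    mul_neg, neg_neg, h1, map_star] at h2
  rw [add_neg_cancel, zero_add, neg_add_eq_sub] at h2
  exact sub_nonneg.1 h2

theorem nonneg_of_forall_nonneg_add_smul {P Q : A} (h : ∀ t : ℝ, 0 < t → 0 ≤ P + t • Q) :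
    0 ≤ P := by
  have hc : Filter.Tendsto (fun t : ℝ => P + t • Q) (nhdsWithin 0 (Set.Ioi 0)) (nhds P) := by
    have : Continuous fun t : ℝ => P + t • Q := by fun_prop
    simpa using (this.tendsto 0).mono_left nhdsWithin_le_nhds
  exact ge_of_tendsto hc (Filter.eventually_of_mem self_mem_nhdsWithin fun t ht => h t ht)

/-- If a unital completely positive map `E` attains equality in the Kadison–Schwarz inequality at
`x`, then `x` lies in its multiplicative domain. -/
theorem CompletelyPositiveMap.map_star_mul_of_map_star_mul_self (E : B →CP A) (h1 : E 1 = 1)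
    {x : B} (hx : E (star x * x) = star (E x) * E x) (y : B) :
    E (star x * y) = star (E x) * E y := by
  -- `D` is an `A`-valued sesquilinear form, positive by Kadison–Schwarz. As `D x x = 0`, a
  -- Cauchy–Schwarz argument shows `D x y = 0`.
  set D : B → B → A := fun x y => E (star x * y) - star (E x) * E y with hD
  have hself (z : B) : 0 ≤ D z z := sub_nonneg.2 (E.star_map_mul_map_le h1 z)
  have hstar (y z : B) : star (D y z) = D z y := by simp [hD, ← map_star]
  have hre (y : B) : 0 ≤ D x y + star (D x y) := by
    refine nonneg_of_forall_nonneg_add_smul (Q := D y y) fun t ht => ?_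
    -- Dividing by `t > 0` and letting `t → 0` leaves `D x y + (D x y)⋆ ≥ 0`.
    have h2 : D (x + (t : ℂ) • y) (x + (t : ℂ) • y)
        = t • (D x y + star (D x y) + t • D y y) := by
      have h3 : D x x = 0 := sub_eq_zero.2 hx
      have h4 : D (x + (t : ℂ) • y) (x + (t : ℂ) • y)
          = D x x + (t : ℂ) • (D x y + D y x + (t : ℂ) • D y y) := by
        simp only [hD, star_add, star_smul, map_add, map_smul, add_mul, mul_add, smul_mul_assoc,
          mul_smul_comm, RCLike.star_def, Complex.conj_ofReal]
        module
      rw [h4, h3, zero_add, hstar, Complex.coe_smul, Complex.coe_smul]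
    have h5 := smul_nonneg (inv_nonneg.2 ht.le) (h2 ▸ hself (x + (t : ℂ) • y))
    rwa [smul_smul, inv_mul_cancel₀ ht.ne', one_smul] at h5
  -- Replacing `y` by `-y` reverses the inequality; replacing it by `i y` below kills the
  -- skew-adjoint part as well.
  have hzero (y : B) : D x y + star (D x y) = 0 := by
    refine le_antisymm ?_ (hre y)
    have h2 : D x (-y) = -D x y := by simp only [hD, mul_neg, map_neg]; abel
    have h3 := hre (-y)
    rw [h2, star_neg, ← neg_add] at h3
    exact neg_nonneg.1 h3
  have hI : D x (Complex.I • y) = Complex.I • D x y := by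
    simp only [hD, mul_smul_comm, map_smul, smul_sub]
  have h2 := hzero (Complex.I • y)
  rw [hI, star_smul, RCLike.star_def, Complex.conj_I, neg_smul, ← sub_eq_add_neg, ← smul_sub,
    smul_eq_zero_iff_right Complex.I_ne_zero, sub_eq_zero] at h2
  have h3 := hzero y
  rw [← h2, ← two_smul ℂ, smul_eq_zero_iff_right two_ne_zero] at h3
  exact sub_eq_zero.1 h3

variable {ι : A →⋆ₐ[ℂ] B} {E : B →CP A}

/-- `E ∘ ι` is the identity, hence multiplicative, so equality holds in Kadison–Schwarz on `ι(A)`.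
-/
theorem IsConditionalExpectation.map_incl_mul (hE : IsConditionalExpectation ι E) (a : A) (x : B) :
    E (ι a * x) = a * E x := by
  have h := E.map_star_mul_of_map_star_mul_self hE.map_one (x := ι (star a))
    (by rw [← map_star, ← map_mul, hE.map_incl, hE.map_incl]) x
  rwa [← map_star, hE.map_incl, star_star] at h

theorem IsConditionalExpectation.map_mul_incl (hE : IsConditionalExpectation ι E) (a : A) (x : B) :
    E (x * ι a) = E x * a := by
  have h := hE.map_incl_mul (star a) (star x)
  rw [map_star, ← star_mul, map_star, map_star, ← star_mul] at h
  exact star_injective h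

end MultiplicativeDomain

/-! ### New expectations from the relative commutant -/

section Perturbation

variable {A B : Type*} [CStarAlgebra A] [PartialOrder A] [StarOrderedRing A]
  [CStarAlgebra B] [PartialOrder B] [StarOrderedRing B] {ι : A →⋆ₐ[ℂ] B} {E : B →CP A}

/-- Compressing a conditional expectation `E` by an element `h` of the relative commutant yields,
after normalisation by the central element `E(h⋆ h)`, another conditional expectation. -/
theorem IsConditionalExpectation.exists_compression (hE : IsConditionalExpectation ι E) (h : B)
    (hcomm : ∀ a, Commute h (ι a)) (hz : IsStrictlyPositive (E (star h * h))) :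
    ∃ F : B →CP A, IsConditionalExpectation ι F ∧ ∀ x, F x = 0 → E (star h * x * h) = 0 := by
  set z := E (star h * h) with hzdef
  have hcomm' (a : A) : Commute (star h) (ι a) := by
    have := (hcomm (star a)).star_star
    rwa [map_star, star_star] at this
  -- `z` is central because `h⋆ h` commutes with `ι(A)` and `E` is a bimodule map.
  have hza (a : A) : Commute z a := by
    change z * a = a * z
    rw [hzdef, ← hE.map_mul_incl, ← hE.map_incl_mul, mul_assoc, (hcomm a).eq, ← mul_assoc,
      (hcomm' a).eq, mul_assoc]
  -- The new map is `x ↦ r E(h⋆ x h) r`. It is unital since `r z r = 1`, fixes `A` since `r` is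
  -- central, and vanishes only where `E(h⋆ x h)` does since `r` is invertible.
  set r : A := z ^ (-(1 / 2) : ℝ) with hr
  have hra (a : A) : Commute r a := (hza a).cfc_nnreal _
  have hrs : star r = r := (IsSelfAdjoint.of_nonneg CFC.rpow_nonneg).star_eq
  have hru : IsUnit r := hz.isUnit.cfcRpow _ hz.nonneg
  have hrzr : r * z * r = 1 := CFC.conjugate_rpow_neg_one_half z hz
  let L : B →ₗ[ℂ] A :=
    { toFun := fun x => r * E (star h * x * h) * r
      map_add' := fun x y => by simp only [mul_add, add_mul, map_add]
      map_smul' := fun c x => by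
        simp only [mul_smul_comm, smul_mul_assoc, map_smul, RingHom.id_apply] }
  have hL (x : B) : L x = r * E (star h * x * h) * r := rfl
  refine ⟨⟨L, fun k M hM => ?_⟩, ⟨?_, fun a => ?_⟩, fun x hx => ?_⟩
  · have h1 := CStarMatrix.nonneg_map_conj
      (E.map_cstarMatrix_nonneg _ (CStarMatrix.nonneg_map_conj hM h)) r
    rw [hrs] at h1
    exact h1
  · change r * E (star h * 1 * h) * r = 1
    rw [mul_one, hrzr]
  · change r * E (star h * ι a * h) * r = a
    rw [(hcomm' a).eq, mul_assoc (ι a), hE.map_incl_mul, ← mul_assoc, (hra a).eq, mul_assoc,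
      mul_assoc, ← mul_assoc r, hrzr, mul_one]
  · change r * E (star h * x * h) * r = 0 at hx
    rwa [hru.mul_left_eq_zero, hru.mul_right_eq_zero] at hx

end Perturbation

/-! ### Freeness and uniqueness -/

section Main
universe u v
variable {A : Type u} {G : Type v} [CStarAlgebra A] [Group G] {α : G →* (A ≃⋆ₐ[ℂ] A)}

namespace FullCrossedProduct

theorem incl_apply (a : A) : incl α a = of α (ConvAlgebra.single α 1 a) := rfl

theorem incl_mul_of_single (a : A) (g : G) (b : A) :
    incl α a * of α (ConvAlgebra.single α g b) = of α (ConvAlgebra.single α g (a * b)) := by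
  rw [incl_apply, ← of_mul, ConvAlgebra.single_mul_single, one_mul, ConvAlgebra.act_one]

theorem of_single_mul_incl (a : A) (g : G) (b : A) :
    of α (ConvAlgebra.single α g b) * incl α a = of α (ConvAlgebra.single α g (b * α g a)) := by
  rw [incl_apply, ← of_mul, ConvAlgebra.single_mul_single, mul_one]

variable [PartialOrder A] [StarOrderedRing A]

/-- A free action admits no conditional expectation other than the canonical one. -/
theorem eq_expectation_of_actsFreely (hα : ActsFreely α) {E : FullCrossedProduct α →CP A}
    (hE : IsConditionalExpectation (incl α) E) : E = expectation α := by
  -- Applying `E` to `u_g a = α_g(a) u_g` makes `E(u_g)` a dependent element for `α_g`.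
  have hu (g : G) (hg : g ≠ 1) : E (of α (ConvAlgebra.single α g 1)) = 0 := by
    refine hα g hg _ fun a => ?_
    rw [← hE.map_mul_incl, ← hE.map_incl_mul, of_single_mul_incl, incl_mul_of_single, one_mul,
      mul_one]
  have hof (f : ConvAlgebra α) : E (of α f) = expectation α (of α f) := by
    induction f using ConvAlgebra.induction_on with
    | h_zero => rw [of_zero, map_zero, map_zero]
    | h_add f g hf hg => rw [of_add, map_add, map_add, hf, hg]
    | h_single g a =>
      rw [expectation_of]
      by_cases hg : g = 1
      · subst hg
        rw [ConvAlgebra.coeffOne_single_one]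
        exact hE.map_incl a
      · rw [ConvAlgebra.coeffOne_single_of_ne α hg, ← mul_one a, ← incl_mul_of_single,
          hE.map_incl_mul, hu g hg, mul_zero]
  exact DFunLike.coe_injective
    ((denseRange_of α).equalizer (map_continuous E) (map_continuous (expectation α)) (funext hof))

theorem expectation_of_single_of_ne {g : G} (hg : g ≠ 1) (a : A) :
    expectation α (of α (ConvAlgebra.single α g a)) = 0 := by
  rw [expectation_of, ConvAlgebra.coeffOne_single_of_ne α hg]

/-- If the canonical conditional expectation is the only one, then the action is free. -/
theorem actsFreely_of_forall_eq_expectation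
    (huniq : ∀ E : FullCrossedProduct α →CP A, IsConditionalExpectation (incl α) E →
      E = expectation α) : ActsFreely α := by
  intro g hg b hb
  have hE := isConditionalExpectation_expectation α
  set E := expectation α
  set w := of α (ConvAlgebra.single α g (star b)) with hw
  have hws : star w = of α (ConvAlgebra.single α g⁻¹ (α g⁻¹ b)) := by
    rw [hw, star_of, ConvAlgebra.star_single, star_star]
  have hww : star w * w = incl α (α g⁻¹ (b * star b)) := by
    rw [hws, hw, ← of_mul, ConvAlgebra.single_mul_single, inv_mul_cancel, map_mul, incl_apply]
  -- The adjoint of `b a⋆ = α_g(a⋆) b` is `a b⋆ = b⋆ α_g(a)`, which says that `w` commutes with `a`.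
  have hcomm (a : A) : Commute w (incl α a) := by
    have h := congrArg star (hb (star a))
    rw [star_mul, star_mul, star_star, map_star, star_star] at h
    change w * incl α a = incl α a * w
    rw [hw, of_single_mul_incl, incl_mul_of_single, h]
  have hEw : E w = 0 := expectation_of_single_of_ne hg _
  have hEws : E (star w) = 0 := by rw [map_star, hEw, star_zero]
  set c := α g⁻¹ (b * star b)
  have hc : 0 ≤ c := by
    have h := star_mul_self_nonneg (α g⁻¹ (star b))
    rwa [← map_star, star_star, ← map_mul] at h
  -- Compress by `h = 1 + t w`, where `E(h⋆ h) = 1 + c` is invertible. By uniqueness the result is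
  -- `E` again, which kills `w⋆`, so `E(h⋆ w⋆ h) = 0`. In the expansion `E(w⋆) = 0` and `E(w⋆ w⋆ w)
  -- = E(w⋆) c = 0`, leaving these two terms.
  have key (t : ℂ) (ht : star t * t = 1) : t • c + star t • E (star w * star w) = 0 := by
    have hz : E (star (1 + t • w) * (1 + t • w)) = 1 + c := by
      have : star (1 + t • w) * (1 + t • w)
          = 1 + t • w + star t • star w + (star t * t) • (star w * w) := by
        simp only [star_add, star_one, star_smul, add_mul, mul_add, one_mul, mul_one,
          smul_mul_assoc, mul_smul_comm]
        module
      rw [this, ht, one_smul, hww]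
      simp only [map_add, map_smul, hEw, hEws, hE.map_one, hE.map_incl, smul_zero, add_zero]
    obtain ⟨F, hF, hF0⟩ := hE.exists_compression (1 + t • w)
      (fun a => (Commute.one_left _).add_left ((hcomm a).smul_left t))
      (hz ▸ isStrictlyPositive_one.add_nonneg hc)
    have h0 := hF0 (star w) (by rw [huniq F hF]; exact hEws)
    have : star (1 + t • w) * star w * (1 + t • w) = star w + t • (star w * w)
        + star t • (star w * star w) + (star t * t) • (star w * (star w * w)) := by
      simp only [star_add, star_one, star_smul, add_mul, mul_add, one_mul, mul_one,
        smul_mul_assoc, mul_smul_comm, mul_assoc]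
      module
    rw [this, ht, one_smul, hww] at h0
    simpa only [map_add, map_smul, hEws, hE.map_incl, hE.map_mul_incl, zero_mul, zero_add,
      add_zero] using h0
  have h1 := key 1 (by simp)
  have h2 := key Complex.I (by simp)
  -- `t = 1` gives `E(w⋆ w⋆) = -c` and `t = i` gives `E(w⋆ w⋆) = c`.
  have hc0 : c = 0 := by
    rw [star_one, one_smul, one_smul] at h1
    rw [eq_neg_of_add_eq_zero_right h1, RCLike.star_def, Complex.conj_I, smul_neg, neg_smul,
      neg_neg, ← two_smul ℂ, smul_smul] at h2
    exact (smul_eq_zero_iff_right (by simp)).1 h2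
  have hbb : b * star b = 0 := (map_eq_zero_iff _ (α g⁻¹).injective).1 hc0
  exact (CStarRing.mul_star_self_eq_zero_iff b).1 hbb

end FullCrossedProduct

end Main

end

theorem corollary3p3 {A : Type*} {G : Type*} [CStarAlgebra A] [PartialOrder A]
    [StarOrderedRing A] [Group G] (α : G →* (A ≃⋆ₐ[ℂ] A)) :
    (∃! E : FullCrossedProduct α →CP A,
      IsConditionalExpectation (FullCrossedProduct.incl α) E) ↔ ActsFreely α := by
  have hE := FullCrossedProduct.isConditionalExpectation_expectation α
  constructor
  · intro h
    exact FullCrossedProduct.actsFreely_of_forall_eq_expectation fun F hF => h.unique hF hE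
  · intro h
    exact ⟨_, hE, fun F hF => FullCrossedProduct.eq_expectation_of_actsFreely h hF⟩
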